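/- Let $n\Delta_2$ be an equilateral triangle of side length $n$, divided by the triangular grid into unit triangles. A \emph{lozenge tiling} of $n\Delta_2$ is a tiling of it by upward unit triangles and unit rhombi of the grid (a unit rhombus is the union of an upward and a downward unit triangle that share a side); it contains exactly $n$ unit triangles. The \emph{position} of an upward unit triangle is the triple $(x_1,x_2,x_3)$ of non-negative integers with sum $n-1$ giving its place in the triangular array of upward unit triangles of $n\Delta_2$. Number the $n$ unit triangles of a lozenge tiling by $1,\dots,n$ in any way. Let color $i$ spread from the $i$-th unit triangle through the tiling: color $i$ is given to the three sides of the $i$-th triangle, and whenever a side of a rhombus has color $i$, so has the opposite side. The \emph{system of permutations} of the numbered tiling is the triple $(u,v,w)$ of permutations of $[n]$ formed by the colors of the $n$ unit edges on each of the three sides of $n\Delta_2$, read clockwise starting from the lower left vertex. It is \emph{acyclic} if there are no $i\neq j$ such that $i$ appears before $j$ in each of $u$, $v$ and $w$. \textbf{Theorem} (Acyclic systems of permutations and triangle positions). Every numbered lozenge tiling of $n\Delta_2$ has a well-defined system of permutations, and this system is acyclic. The system of permutations determines uniquely the numbered positions of the unit triangles: if two numbered lozenge tilings of $n\Delta_2$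 have the same system of permutations, then for each $i$ their $i$-th unit triangles have the same position. Conversely, the numbered positions of the unit triangles and any one permutation of the system determine uniquely the other two permutations: if two numbered lozenge tilings of $n\Delta_2$ have, for each $i$, the $i$-th unit triangle in the same position, and if their systems of permutations agree on one side of $n\Delta_2$, then they agree on all three sides. -/

import Mathlib

/-! Corners of the equilateral triangle of side `n` are indexed by `Fin 3`:
`0` = lower left, `1` = top, `2` = lower right, so `0 → 1 → 2 → 0` is the clockwise order.
Barycentric coordinates are triples `Fin 3 → ℕ`; the lattice points of the triangle are the triples
with sum `n`. We write `eₐ` for the unit vector `Pi.single a 1`. -/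

namespace Lozenge

/-- The unit triangles of the triangular grid.
`up x` has vertices `x + e₀`, `x + e₁`, `x + e₂`.
`down y` has vertices `y + e₀ + e₁`, `y + e₁ + e₂`, `y + e₂ + e₀`. -/
inductive Cell where
  | up (x : Fin 3 → ℕ) : Cell
  | down (y : Fin 3 → ℕ) : Cell

/-- The unit triangles that lie in the triangle of side `n`. -/
def Cell.Inside (n : ℕ) : Cell → Prop
  | .up x => (∑ a, x a) + 1 = n
  | .down y => (∑ a, y a) + 2 = n

/-- The four kinds of tiles: the upward unit triangle `up x`, and for each of the three orientations
`c` the unit rhombus made of `down y` and the upward triangle `up (y + e_c)`, which shares a side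
with `down y`. -/
inductive Tile where
  | triangle (x : Fin 3 → ℕ) : Tile
  | rhombus (y : Fin 3 → ℕ) (c : Fin 3) : Tile

/-- The unit triangles that make up a tile. -/
def Tile.cells : Tile → Set Cell
  | .triangle x => {.up x}
  | .rhombus y c => {.down y, .up (y + Pi.single c 1)}

/-- A lozenge tiling of the triangle of side `n`: a set of tiles inside the triangle such that every
unit triangle of it is covered by exactly one tile. -/
structure LozengeTiling (n : ℕ) where
  tiles : Set Tile
  inside : ∀ t ∈ tiles, ∀ d ∈ t.cells, d.Inside n
  covers : ∀ d : Cell, d.Inside n → ∃! t, t ∈ tiles ∧ d ∈ t.cells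

/-- A numbering of the unit triangles of a lozenge tiling: `pos i` is the position of the `i`-th
one. -/
structure TriangleNumbering {n : ℕ} (T : LozengeTiling n) where
  pos : Fin n → Fin 3 → ℕ
  injective : Function.Injective pos
  range_eq : Set.range pos = {x | Tile.triangle x ∈ T.tiles}

/-- Unit edges of the grid. Every unit edge is a side of exactly one upward unit triangle:
`⟨x, c⟩` is the side of `up x` opposite to its vertex `x + e_c`. -/
structure Edge where
  base : Fin 3 → ℕ
  dir : Fin 3

/-- The color `i` spreads from the `i`-th unit triangle of the tiling through the rhombi: it crosses
the three sides of the triangle numbered `i`, and when it enters a rhombus through one side it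
leaves through the opposite (parallel) side. The rhombus `(y, c)` has, for each `a ≠ c`, the two
opposite sides `⟨y + e_c, a⟩` (on its upward half) and `⟨y + e_a, a⟩` (on its downward half). -/
inductive HasColor {n : ℕ} {T : LozengeTiling n} (ν : TriangleNumbering T) (i : Fin n) :
    Edge → Prop
  | side (c : Fin 3) : HasColor ν i ⟨ν.pos i, c⟩
  | up_to_down (y : Fin 3 → ℕ) (c a : Fin 3) (ht : Tile.rhombus y c ∈ T.tiles) (hac : a ≠ c)
      (h : HasColor ν i ⟨y + Pi.single c 1, a⟩) : HasColor ν i ⟨y + Pi.single a 1, a⟩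
  | down_to_up (y : Fin 3 → ℕ) (c a : Fin 3) (ht : Tile.rhombus y c ∈ T.tiles) (hac : a ≠ c)
      (h : HasColor ν i ⟨y + Pi.single a 1, a⟩) : HasColor ν i ⟨y + Pi.single c 1, a⟩

/-- The `k`-th unit edge (`k = 0, …, n - 1`) on the side of the big triangle that goes clockwise from
corner `s` to corner `s + 1`. -/
def boundaryEdge (n : ℕ) (s : Fin 3) (k : Fin n) : Edge :=
  ⟨Pi.single s (n - 1 - (k : ℕ)) + Pi.single (s + 1) (k : ℕ), s + 2⟩

/-- `σ = (σ 0, σ 1, σ 2)` is the system of permutations of the numbered tiling: `σ s k` is the color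
of the `k`-th edge on the side from corner `s` to corner `s + 1`, so the three permutations are read
clockwise, starting from the lower left corner. -/
def IsSystemOfPermutations {n : ℕ} {T : LozengeTiling n} (ν : TriangleNumbering T)
    (σ : Fin 3 → Equiv.Perm (Fin n)) : Prop :=
  ∀ (s : Fin 3) (k : Fin n), HasColor ν (σ s k) (boundaryEdge n s k)

/-- No two numbers `i ≠ j` appear in the same order, `i` before `j`, in all three permutations. -/
def Acyclic {n : ℕ} (σ : Fin 3 → Equiv.Perm (Fin n)) : Prop :=
  ¬ ∃ i j : Fin n, ∀ s : Fin 3, (σ s).symm i < (σ s).symm j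

end Lozenge

/-! In direction `a`, color `i` follows a path from its triangle to the side opposite corner `a`:
each rhombus lowers coordinate `a` by one and decreases no other. A rhombus determines both the
previous and the next edge, so paths of one direction neither merge nor cross. This yields the
permutations (`exists_unique_system`). Comparing starts of paths with their ends gives sign
conditions on position differences that exclude a common order (`not_before_all`).

The path of `i` in direction `b` crosses `pos i b` rhombi, and in each it meets a path of some color
`j`. These `j` are distinct and satisfy `Crosses σ b i j`, a condition on `σ` alone (`pos_le_card`).
By acyclicity the three sets `Crosses σ b i` are disjoint, and they omit `i`, so their sizes sum to
at most `n - 1`, the sum of the coordinates. Hence all the bounds are equalities (`pos_eq_card`),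
and `σ` determines the positions. Conversely, these sizes are inversion counts of one permutation
relative to another, that is, a Lehmer code, which recovers the second from the first
(`lt_iff_lt_of_inversions_eq`). -/

namespace Lozenge

/-! ### Cyclic indices and barycentric coordinates. -/

section Coordinates

theorem eq_add_one_or_of_ne {a c : Fin 3} (h : c ≠ a) : c = a + 1 ∨ c = a + 2 := by
  revert a c; decide

theorem add_one_add_one (a : Fin 3) : a + 1 + 1 = a + 2 := by revert a; decide

theorem add_one_add_two (a : Fin 3) : a + 1 + 2 = a := by revert a; decide

theorem add_two_add_one (a : Fin 3) : a + 2 + 1 = a := by revert a; decide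

theorem add_two_add_two (a : Fin 3) : a + 2 + 2 = a + 1 := by revert a; decide

theorem add_one_ne (a : Fin 3) : a + 1 ≠ a := by revert a; decide

theorem add_two_ne (a : Fin 3) : a + 2 ≠ a := by revert a; decide

theorem exists_third (b d : Fin 3) : ∃ c, b ≠ c ∧ c ≠ d := by revert b d; decide

theorem third_unique {b c d d' : Fin 3} (hbc : b ≠ c) (hbd : b ≠ d) (hcd : c ≠ d) (hbd' : b ≠ d')
    (hcd' : c ≠ d') : d = d' := by
  revert b c d d'; decide

theorem sum_eq_cyclic (x : Fin 3 → ℕ) (a : Fin 3) : ∑ c, x c = x a + x (a + 1) + x (a + 2) := by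
  fin_cases a <;> simp [Fin.sum_univ_three] <;> ring

theorem ext_cyclic {x z : Fin 3 → ℕ} (a : Fin 3) (h0 : x a = z a) (h1 : x (a + 1) = z (a + 1))
    (h2 : x (a + 2) = z (a + 2)) : x = z := by
  funext c
  by_cases hc : c = a
  · rw [hc, h0]
  · rcases eq_add_one_or_of_ne hc with rfl | rfl <;> assumption

theorem add_single_same (y : Fin 3 → ℕ) (c : Fin 3) : (y + Pi.single c 1 : Fin 3 → ℕ) c = y c + 1 := by simp

theorem add_single_ne (y : Fin 3 → ℕ) {c d : Fin 3} (h : d ≠ c) :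
    (y + Pi.single c 1 : Fin 3 → ℕ) d = y d := by simp [h]

theorem sum_add_single (y : Fin 3 → ℕ) (c : Fin 3) :
    ∑ a, (y + Pi.single c 1 : Fin 3 → ℕ) a = (∑ a, y a) + 1 := by
  simp [Finset.sum_add_distrib]

end Coordinates

/-! ### Color paths of a tiling: order and crossings. -/

section Tiling

variable {n : ℕ} (T : LozengeTiling n)

theorem rhombus_dir_unique {y : Fin 3 → ℕ} {c c' : Fin 3} (h : Tile.rhombus y c ∈ T.tiles)
    (h' : Tile.rhombus y c' ∈ T.tiles) : c = c' := by
  have hin := T.inside _ h (.down y) (by simp [Tile.cells])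
  have := (T.covers _ hin).unique ⟨h, by simp [Tile.cells]⟩ ⟨h', by simp [Tile.cells]⟩
  simpa using this

theorem rhombus_unique_of_up {y y' : Fin 3 → ℕ} {c c' : Fin 3} (h : Tile.rhombus y c ∈ T.tiles)
    (h' : Tile.rhombus y' c' ∈ T.tiles) (e : y + Pi.single c 1 = y' + Pi.single c' 1) :
    y = y' ∧ c = c' := by
  have hin := T.inside _ h (.up (y + Pi.single c 1)) (by simp [Tile.cells])
  have := (T.covers _ hin).unique ⟨h, by simp [Tile.cells]⟩ ⟨h', by simp [Tile.cells, e]⟩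
  simpa using this

theorem triangle_ne_rhombus {x y : Fin 3 → ℕ} {c : Fin 3} (h : Tile.triangle x ∈ T.tiles)
    (h' : Tile.rhombus y c ∈ T.tiles) : x ≠ y + Pi.single c 1 := by
  intro e
  have hin := T.inside _ h (.up x) (by simp [Tile.cells])
  have := (T.covers _ hin).unique ⟨h, by simp [Tile.cells]⟩ ⟨h', by simp [Tile.cells, e]⟩
  simp at this

theorem triangle_sum {x : Fin 3 → ℕ} (h : Tile.triangle x ∈ T.tiles) : (∑ a, x a) + 1 = n :=
  T.inside _ h (.up x) (by simp [Tile.cells])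

/-- A color that moves in direction `a` away from its unit triangle crosses a rhombus from the
upward triangle `x` to the upward triangle `z`. -/
def Step (a : Fin 3) (x z : Fin 3 → ℕ) : Prop :=
  ∃ y c, Tile.rhombus y c ∈ T.tiles ∧ c ≠ a ∧ x = y + Pi.single a 1 ∧ z = y + Pi.single c 1

/-- A color that moves in direction `a` gets from `x` to `z`. -/
abbrev Desc (a : Fin 3) : (Fin 3 → ℕ) → (Fin 3 → ℕ) → Prop :=
  Relation.ReflTransGen (Step T a)

/-- The side `⟨x, a⟩` is not the short diagonal of a rhombus of the tiling. -/
def Visible (a : Fin 3) (x : Fin 3 → ℕ) : Prop :=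
  (∑ c, x c) + 1 = n ∧ ∀ y, Tile.rhombus y a ∈ T.tiles → x ≠ y + Pi.single a 1

variable {T} {a : Fin 3} {x x' z z' : Fin 3 → ℕ}

theorem Step.right_unique (h : Step T a x z) (h' : Step T a x z') : z = z' := by
  obtain ⟨y, c, ht, -, rfl, rfl⟩ := h
  obtain ⟨y', c', ht', -, e, rfl⟩ := h'
  obtain rfl := add_right_cancel e
  rw [rhombus_dir_unique T ht ht']

theorem Step.left_unique (h : Step T a x z) (h' : Step T a x' z) : x = x' := by
  obtain ⟨y, c, ht, -, rfl, rfl⟩ := h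
  obtain ⟨y', c', ht', -, rfl, e⟩ := h'
  rw [(rhombus_unique_of_up T ht ht' e).1]

theorem Step.not_triangle (h : Step T a x z) : Tile.triangle z ∉ T.tiles := by
  obtain ⟨y, c, ht, -, -, rfl⟩ := h
  exact fun h => triangle_ne_rhombus T h ht rfl

theorem Step.sum_eq (h : Step T a x z) : ∑ c, z c = ∑ c, x c := by
  obtain ⟨y, c, -, -, rfl, rfl⟩ := h
  simp only [sum_add_single]

theorem Step.level (h : Step T a x z) : z a + 1 = x a := by
  obtain ⟨y, c, -, hc, rfl, rfl⟩ := h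
  rw [add_single_same, add_single_ne _ hc.symm]

theorem Step.le (h : Step T a x z) {d : Fin 3} (hd : d ≠ a) : x d ≤ z d := by
  obtain ⟨y, c, -, hc, rfl, rfl⟩ := h
  rw [add_single_ne _ hd]; simp

theorem Step.le_add_one (h : Step T a x z) (d : Fin 3) : z d ≤ x d + 1 := by
  obtain ⟨y, c, -, hc, rfl, rfl⟩ := h
  by_cases hd : d = c
  · subst hd; simp
  · rw [add_single_ne _ hd]; simp; omega

theorem Step.visible (h : Step T a x z) : Visible T a z := by
  obtain ⟨y, c, ht, hc, rfl, rfl⟩ := h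
  refine ⟨T.inside _ ht (.up _) (by simp [Tile.cells]), fun y' ht' e => hc ?_⟩
  exact (rhombus_unique_of_up T ht ht' e).2

theorem visible_of_triangle (h : Tile.triangle x ∈ T.tiles) : Visible T a x :=
  ⟨triangle_sum T h, fun _ ht => triangle_ne_rhombus T h ht⟩

theorem visible_source_of_rhombus {y : Fin 3 → ℕ} {c : Fin 3} (ht : Tile.rhombus y c ∈ T.tiles)
    (hc : a ≠ c) : Visible T a (y + Pi.single a 1) := by
  have := T.inside _ ht (.down y) (by simp [Tile.cells])
  refine ⟨?_, fun y' ht' e => ?_⟩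
  · rw [sum_add_single]; exact this
  · obtain rfl := add_right_cancel e
    exact hc (rhombus_dir_unique T ht' ht)

theorem Visible.exists_step (h : Visible T a x) (hx : 0 < x a) : ∃ z, Step T a x z := by
  obtain ⟨y, rfl⟩ : ∃ y : Fin 3 → ℕ, x = y + Pi.single a 1 := by
    refine ⟨x - Pi.single a 1, ?_⟩
    funext c
    by_cases hc : c = a
    · rw [hc]; simp; omega
    · simp [hc]
  obtain ⟨hs, hv⟩ := h
  rw [sum_add_single] at hs
  obtain ⟨t, ⟨ht, hd⟩, -⟩ := T.covers (.down y) hs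
  cases t with
  | triangle x => simp [Tile.cells] at hd
  | rhombus y' c =>
    obtain rfl : y = y' := by simpa [Tile.cells] using hd
    refine ⟨_, y, c, ht, ?_, rfl, rfl⟩
    rintro rfl
    exact hv y ht rfl

theorem Visible.triangle_or_step (h : Visible T a z) :
    Tile.triangle z ∈ T.tiles ∨ ∃ x, Step T a x z ∧ Visible T a x := by
  obtain ⟨hs, hv⟩ := h
  obtain ⟨t, ⟨ht, hd⟩, -⟩ := T.covers (.up z) hs
  cases t with
  | triangle x =>
    obtain rfl : z = x := by simpa [Tile.cells] using hd
    exact Or.inl ht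
  | rhombus y c =>
    obtain rfl : z = y + Pi.single c 1 := by simpa [Tile.cells] using hd
    have hc : c ≠ a := by rintro rfl; exact hv y ht rfl
    exact Or.inr ⟨_, ⟨y, c, ht, hc, rfl, rfl⟩, visible_source_of_rhombus ht hc.symm⟩

/-- Walking backwards raises coordinate `a`, which is less than `n`, so the walk stops, and it can
only stop at a unit triangle. -/
theorem Visible.exists_triangle (h : Visible T a z) :
    ∃ x, Tile.triangle x ∈ T.tiles ∧ Desc T a x z := by
  obtain ⟨m, hm⟩ : ∃ m, m = n - z a := ⟨_, rfl⟩
  induction m using Nat.strong_induction_on generalizing z with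
  | _ m ih =>
    rcases h.triangle_or_step with ht | ⟨x, hx, hv⟩
    · exact ⟨z, ht, .refl⟩
    · have h1 := hx.level
      have h2 := hv.1
      rw [sum_eq_cyclic x a] at h2
      obtain ⟨w, hw, hd⟩ := ih (n - x a) (by omega) hv rfl
      exact ⟨w, hw, hd.tail hx⟩

theorem Visible.of_desc (hx : Visible T a x) (h : Desc T a x z) : Visible T a z := by
  cases h with
  | refl => exact hx
  | tail _ h => exact h.visible

theorem Desc.sum_eq (h : Desc T a x z) : ∑ c, z c = ∑ c, x c := by
  induction h with
  | refl => rfl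
  | tail _ h ih => rw [h.sum_eq, ih]

theorem Desc.level_le (h : Desc T a x z) : z a ≤ x a := by
  induction h with
  | refl => rfl
  | tail _ h ih => have := h.level; omega

theorem Desc.le (h : Desc T a x z) {d : Fin 3} (hd : d ≠ a) : x d ≤ z d := by
  induction h with
  | refl => rfl
  | tail _ h ih => exact ih.trans (h.le hd)

theorem Desc.eq_of_level_le (h : Desc T a x z) (hl : x a ≤ z a) : x = z := by
  cases h with
  | refl => rfl
  | tail h h' => have := h'.level; have := Desc.level_le h; omega

theorem Desc.total (h : Desc T a x z) (h' : Desc T a x z') : Desc T a z z' ∨ Desc T a z' z :=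
  Relation.ReflTransGen.total_of_right_unique (r := Step T a)
    (fun _ _ _ h h' => Step.right_unique h h') h h'

theorem Desc.of_level_le (h : Desc T a x z) (h' : Desc T a x z') (hl : z' a ≤ z a) :
    Desc T a z z' := by
  rcases h.total h' with h | h
  · exact h
  · rw [h.eq_of_level_le hl]

theorem Desc.right_unique (h : Desc T a x z) (h' : Desc T a x z') (hl : z a = z' a) : z = z' :=
  (h.of_level_le h' hl.ge).eq_of_level_le hl.le

theorem Desc.left_unique_triangle (hx : Tile.triangle x ∈ T.tiles)
    (hx' : Tile.triangle x' ∈ T.tiles) (h : Desc T a x z) (h' : Desc T a x' z) : x = x' := by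
  induction h with
  | refl =>
    cases h' with
    | refl => rfl
    | tail _ h' => exact absurd hx h'.not_triangle
  | tail _ h ih =>
    cases h' with
    | refl => exact absurd hx' h.not_triangle
    | tail h₁ h' =>
      obtain rfl := h.left_unique h'
      exact ih h₁

theorem Visible.exists_desc (hx : Visible T a x) {k : ℕ} (hk : k ≤ x a) :
    ∃ z, Desc T a x z ∧ z a = k := by
  induction hk using Nat.decreasingInduction with
  | self => exact ⟨x, .refl, rfl⟩
  | of_succ k _ ih =>
    obtain ⟨z, hz, hzk⟩ := ih
    obtain ⟨w, hw⟩ := (hx.of_desc hz).exists_step (by omega)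
    exact ⟨w, hz.tail hw, by have := hw.level; omega⟩

/-- Two paths of the same direction keep their order. -/
theorem Desc.lt_of_lt {d : Fin 3} (hd : d ≠ a) (hs : ∑ c, x c = ∑ c, x' c) (hl : x a = x' a)
    (hlt : x d < x' d) (h : Desc T a x z) (h' : Desc T a x' z') (hl' : z a = z' a) :
    z d < z' d := by
  induction h generalizing z' with
  | refl =>
    obtain rfl := h'.eq_of_level_le (by omega)
    exact hlt
  | @tail w v hw hv ih =>
    cases h' with
    | refl => have := Desc.level_le hw; have := hv.level; omega
    | @tail w' _ hw' hv' =>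
      have h1 := hv.level
      have h2 := hv'.level
      have hlt' := ih hw' (by omega)
      have h3 := hv.le_add_one d
      have h4 := hv'.le hd
      rcases Nat.lt_or_ge (v d) (z' d) with h5 | h5
      · exact h5
      -- One step moves a coordinate by at most one, so overtaking would need a merge, excluded by
      -- `Step.left_unique`.
      · exfalso
        have e : v d = z' d := by omega
        have s : ∑ c, v c = ∑ c, z' c := by
          rw [hv.sum_eq, hv'.sum_eq, Desc.sum_eq hw, Desc.sum_eq hw', hs]
        have : v = z' := by
          rw [sum_eq_cyclic v a, sum_eq_cyclic z' a] at s
          rcases eq_add_one_or_of_ne hd with rfl | rfl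
          · exact ext_cyclic a hl' e (by omega)
          · exact ext_cyclic a hl' (by omega) e
        subst this
        obtain rfl := hv.left_unique hv'
        omega

theorem Desc.lt_iff {d : Fin 3} (hd : d ≠ a) (hs : ∑ c, x c = ∑ c, x' c) (hl : x a = x' a)
    (h : Desc T a x z) (h' : Desc T a x' z') (hl' : z a = z' a) :
    x d < x' d ↔ z d < z' d := by
  refine ⟨fun hlt => h.lt_of_lt hd hs hl hlt h' hl', fun hlt => ?_⟩
  rcases lt_trichotomy (x d) (x' d) with h1 | h1 | h1
  · exact h1
  · have : x = x' := by
      rw [sum_eq_cyclic x a, sum_eq_cyclic x' a] at hs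
      rcases eq_add_one_or_of_ne hd with rfl | rfl
      · exact ext_cyclic a hl h1 (by omega)
      · exact ext_cyclic a hl (by omega) h1
    subst this
    obtain rfl := h.right_unique h' hl'
    exact absurd hlt (lt_irrefl _)
  · have := h'.lt_of_lt hd hs.symm hl.symm h1 h hl'.symm
    omega

/-- The path with the higher start is followed down to the level of the other start, where order
agrees with that of the ends; coordinate `d` has not decreased on the way. -/
theorem Desc.lt_of_end_lt {d : Fin 3} (hd : d ≠ a) (hx : Visible T a x) (hx' : Visible T a x')
    (hl : x' a ≤ x a) (h : Desc T a x z) (h' : Desc T a x' z') (hz : z a = 0) (hz' : z' a = 0)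
    (hlt : z d < z' d) : x d < x' d := by
  obtain ⟨v, hv, hva⟩ := hx.exists_desc hl
  have hs : ∑ c, v c = ∑ c, x' c := by
    have := hv.sum_eq; have := hx.1; have := hx'.1; omega
  have := (Desc.lt_iff hd hs hva (hv.of_level_le h (by omega)) h' (hz.trans hz'.symm)).2 hlt
  exact (hv.le hd).trans_lt this

/-- If two paths of different directions cross in a rhombus, the one starts on a known side of the
other. -/
theorem end_lt_of_crossing {b c d : Fin 3} (hbc : b ≠ c) (hbd : b ≠ d) (hcd : c ≠ d)
    {y w : Fin 3 → ℕ} (ht : Tile.rhombus y d ∈ T.tiles) (hx : Visible T b x)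
    (hxy : Desc T b x (y + Pi.single b 1)) (hwy : Desc T c w (y + Pi.single c 1))
    (h : Desc T b x z) (h' : Desc T b w z') (hz : z b = 0) (hz' : z' b = 0) : z c < z' c := by
  -- Going back from the crossing along the `c`-path, the `b`-path stays on its smaller-`c` side at
  -- equal `b`-level: a backward step adds one to `c`, while a compensating step of the `b`-path
  -- adds at most one.
  have key : ∃ v, Desc T b x v ∧ v b = w b ∧ v c < w c := by
    clear h'
    induction hwy using Relation.ReflTransGen.head_induction_on with
    | refl =>
      refine ⟨y + Pi.single d 1, hxy.tail ⟨y, d, ht, hbd.symm, rfl, rfl⟩, ?_, ?_⟩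
      · rw [add_single_ne _ hbd, add_single_ne _ hbc]
      · rw [add_single_ne _ hcd, add_single_same]; omega
    | @head w w₁ hw _ ih =>
      obtain ⟨v, hv, hvb, hvc⟩ := ih
      have h1 := hw.level
      have h2 := hw.le hbc
      have h3 := hw.le_add_one b
      rcases Nat.lt_or_ge (w b) (w₁ b) with h4 | h4
      · obtain ⟨u, hu⟩ := (hx.of_desc hv).exists_step (by omega)
        have h5 := hu.level
        have h6 := hu.le_add_one c
        exact ⟨u, hv.tail hu, by omega, by omega⟩
      · exact ⟨v, hv, by omega, by omega⟩
  obtain ⟨v, hv, hvb, hvc⟩ := key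
  have hs : ∑ a, v a = ∑ a, w a := by
    rw [hv.sum_eq, ← hxy.sum_eq, ← hwy.sum_eq, sum_add_single, sum_add_single]
  exact Desc.lt_of_lt hbc.symm hs hvb hvc (hv.of_level_le h (by omega)) h' (hz.trans hz'.symm)

/-- Two paths of different directions cross at most once. -/
theorem not_level_lt_of_crossings {b c d : Fin 3} (hbc : b ≠ c) (hbd : b ≠ d) (hcd : c ≠ d)
    {y y' w : Fin 3 → ℕ} (ht : Tile.rhombus y d ∈ T.tiles) (ht' : Tile.rhombus y' d ∈ T.tiles)
    (hxy : Desc T b x (y + Pi.single b 1)) (hxy' : Desc T b x (y' + Pi.single b 1))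
    (hwy : Desc T c w (y + Pi.single c 1)) (hwy' : Desc T c w (y' + Pi.single c 1)) :
    ¬ y' b < y b := by
  intro hlt
  have h1 : Desc T b (y + Pi.single d 1) (y' + Pi.single b 1) := by
    refine Desc.of_level_le (hxy.tail ⟨y, d, ht, hbd.symm, rfl, rfl⟩) hxy' ?_
    rw [add_single_ne _ hbd, add_single_same]; omega
  have h2 := h1.le hbd.symm
  rw [add_single_same, add_single_ne _ hbd.symm] at h2
  have h3 : Desc T c w (y' + Pi.single d 1) := hwy'.tail ⟨y', d, ht', hcd.symm, rfl, rfl⟩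
  -- On the `c`-path either order of the two rhombi fails: one would decrease coordinate `d`, the
  -- other coordinate `b`.
  rcases h3.total hwy with h | h
  · have := Desc.le h hcd.symm
    rw [add_single_same, add_single_ne _ hcd.symm] at this
    omega
  · have := Desc.le h hbc
    rw [add_single_ne _ hbc, add_single_ne _ hbd] at this
    omega

end Tiling

/-! ### The system of permutations and its acyclicity. -/

section Numbering

variable {n : ℕ} {T : LozengeTiling n} (ν : TriangleNumbering T)

theorem TriangleNumbering.mem_tiles (i : Fin n) : Tile.triangle (ν.pos i) ∈ T.tiles := by
  have : ν.pos i ∈ Set.range ν.pos := ⟨i, rfl⟩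
  rwa [ν.range_eq] at this

theorem TriangleNumbering.exists_pos_eq {x : Fin 3 → ℕ} (h : Tile.triangle x ∈ T.tiles) :
    ∃ i, ν.pos i = x := by
  have : x ∈ Set.range ν.pos := by rw [ν.range_eq]; exact h
  exact this

variable {ν}

/-- Spreading back through a rhombus only retraces the path, since the preceding edge is unique and
the path cannot back up past its own triangle. -/
theorem desc_of_hasColor {i : Fin n} {e : Edge} (h : HasColor ν i e) :
    Desc T e.dir (ν.pos i) e.base := by
  induction h with
  | side c => exact .refl
  | up_to_down y c a ht hac _ ih =>
    rcases Relation.ReflTransGen.cases_tail ih with h | ⟨w, hw, hs⟩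
    · exact absurd h.symm (triangle_ne_rhombus T (ν.mem_tiles i) ht)
    · obtain rfl := hs.left_unique ⟨y, c, ht, hac.symm, rfl, rfl⟩
      exact hw
  | down_to_up y c a ht hac _ ih => exact ih.tail ⟨y, c, ht, hac.symm, rfl, rfl⟩

theorem hasColor_of_desc {i : Fin n} {a : Fin 3} {x : Fin 3 → ℕ} (h : Desc T a (ν.pos i) x) :
    HasColor ν i ⟨x, a⟩ := by
  induction h with
  | refl => exact .side a
  | tail _ h ih =>
    obtain ⟨y, c, ht, hc, rfl, rfl⟩ := h
    exact .down_to_up y c a ht hc.symm ih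

theorem color_unique {i j : Fin n} {e : Edge} (h : HasColor ν i e) (h' : HasColor ν j e) :
    i = j :=
  ν.injective (Desc.left_unique_triangle (ν.mem_tiles i) (ν.mem_tiles j)
    (desc_of_hasColor h) (desc_of_hasColor h'))

theorem boundary_base_level (s : Fin 3) (k : Fin n) : (boundaryEdge n s k).base (s + 2) = 0 := by
  revert s; simp [boundaryEdge]

theorem boundary_base_index (s : Fin 3) (k : Fin n) : (boundaryEdge n s k).base (s + 1) = k := by
  revert s; simp [boundaryEdge]

theorem boundary_base_self (s : Fin 3) (k : Fin n) :
    (boundaryEdge n s k).base s = n - 1 - (k : ℕ) := by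
  revert s; simp [boundaryEdge]

theorem exists_boundaryEdge_color (ν : TriangleNumbering T) (s : Fin 3) (i : Fin n) :
    ∃ k, HasColor ν i (boundaryEdge n s k) := by
  have hv : Visible T (s + 2) (ν.pos i) := visible_of_triangle (ν.mem_tiles i)
  obtain ⟨z, hz, hz0⟩ := hv.exists_desc (Nat.zero_le _)
  have hs := (hv.of_desc hz).1
  rw [sum_eq_cyclic z s] at hs
  refine ⟨⟨z (s + 1), by omega⟩, ?_⟩
  have : boundaryEdge n s ⟨z (s + 1), by omega⟩ = ⟨z, s + 2⟩ := by
    rw [Edge.mk.injEq (boundaryEdge n s ⟨z (s + 1), by omega⟩).base]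
    refine ⟨ext_cyclic s ?_ (boundary_base_index _ _) ?_, rfl⟩
    · rw [boundary_base_self]; dsimp only; omega
    · rw [boundary_base_level, hz0]
  rw [this]
  exact hasColor_of_desc hz

theorem boundaryEdge_color_unique {s : Fin 3} {i k l : Fin n}
    (h : HasColor ν i (boundaryEdge n s k)) (h' : HasColor ν i (boundaryEdge n s l)) : k = l := by
  have : (boundaryEdge n s k).base = (boundaryEdge n s l).base :=
    Desc.right_unique (T := T) (a := s + 2) (x := ν.pos i) (desc_of_hasColor h)
      (desc_of_hasColor h') ((boundary_base_level s k).trans (boundary_base_level s l).symm)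
  rw [Fin.ext_iff, ← boundary_base_index s k, ← boundary_base_index s l, this]

theorem exists_unique_system (ν : TriangleNumbering T) :
    ∃! σ : Fin 3 → Equiv.Perm (Fin n), IsSystemOfPermutations ν σ := by
  choose f hf using exists_boundaryEdge_color ν
  have hinj : ∀ s, Function.Injective (f s) := fun s i j h =>
    color_unique (hf s i) (h ▸ hf s j)
  refine ⟨fun s => (Equiv.ofBijective (f s) (Finite.injective_iff_bijective.1 (hinj s))).symm,
    fun s k => ?_, fun σ hσ => ?_⟩
  · have := hf s ((Equiv.ofBijective (f s) (Finite.injective_iff_bijective.1 (hinj s))).symm k)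
    rwa [Equiv.ofBijective_apply_symm_apply (f s)] at this
  · funext s
    rw [← Equiv.symm_bijective.injective.eq_iff]
    ext1 i
    refine boundaryEdge_color_unique (ν := ν) (s := s) (i := i) ?_ (hf s i)
    simpa using hσ s ((σ s).symm i)

variable {σ : Fin 3 → Equiv.Perm (Fin n)}

/-- `i` comes before `j` on the side opposite to the corner `a`. -/
def Before (σ : Fin 3 → Equiv.Perm (Fin n)) (a : Fin 3) (i j : Fin n) : Prop :=
  (σ (a + 1)).symm i < (σ (a + 1)).symm j

theorem IsSystemOfPermutations.exists_end (hσ : IsSystemOfPermutations ν σ) (a : Fin 3)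
    (i : Fin n) :
    ∃ z, Desc T a (ν.pos i) z ∧ z a = 0 ∧ z (a + 2) = (σ (a + 1)).symm i := by
  have h := hσ (a + 1) ((σ (a + 1)).symm i)
  rw [Equiv.apply_symm_apply] at h
  have h1 := desc_of_hasColor h
  have h2 := boundary_base_level (a + 1) ((σ (a + 1)).symm i)
  have h3 := boundary_base_index (a + 1) ((σ (a + 1)).symm i)
  have e : a + 1 + 2 = a := add_one_add_two a
  have e' : a + 1 + 1 = a + 2 := add_one_add_one a
  refine ⟨_, ?_, e ▸ h2, e' ▸ h3⟩
  convert h1 using 1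
  exact e.symm

theorem IsSystemOfPermutations.before_iff (hσ : IsSystemOfPermutations ν σ) {a : Fin 3}
    {i j : Fin n} {z z' : Fin 3 → ℕ} (h : Desc T a (ν.pos i) z) (h' : Desc T a (ν.pos j) z')
    (hz : z a = 0) (hz' : z' a = 0) : Before σ a i j ↔ z (a + 2) < z' (a + 2) := by
  obtain ⟨w, hw, hw0, hwk⟩ := hσ.exists_end a i
  obtain ⟨w', hw', hw0', hwk'⟩ := hσ.exists_end a j
  obtain rfl := h.right_unique hw (hz.trans hw0.symm)
  obtain rfl := h'.right_unique hw' (hz'.trans hw0'.symm)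
  rw [Before, Fin.lt_def, hwk, hwk']

theorem pos_sum (ν : TriangleNumbering T) (i : Fin n) (a : Fin 3) :
    ν.pos i a + ν.pos i (a + 1) + ν.pos i (a + 2) + 1 = n := by
  rw [← sum_eq_cyclic]; exact triangle_sum T (ν.mem_tiles i)

theorem end_index_lt_iff {i j : Fin n} {a : Fin 3}
    {z z' : Fin 3 → ℕ} (h : Desc T a (ν.pos i) z) (h' : Desc T a (ν.pos j) z')
    (hz : z a = 0) (hz' : z' a = 0) : z (a + 2) < z' (a + 2) ↔ z' (a + 1) < z (a + 1) := by
  have h1 := h.sum_eq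
  have h2 := h'.sum_eq
  rw [sum_eq_cyclic _ a, sum_eq_cyclic _ a] at h1 h2
  have h3 := pos_sum ν i a
  have h4 := pos_sum ν j a
  omega

theorem IsSystemOfPermutations.pos_lt_of_before (hσ : IsSystemOfPermutations ν σ) {a : Fin 3}
    {i j : Fin n} (h : Before σ a i j) :
    (ν.pos j a ≤ ν.pos i a → ν.pos i (a + 2) < ν.pos j (a + 2)) ∧
    (ν.pos i a ≤ ν.pos j a → ν.pos j (a + 1) < ν.pos i (a + 1)) := by
  obtain ⟨z, hz, hz0, -⟩ := hσ.exists_end a i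
  obtain ⟨z', hz', hz0', -⟩ := hσ.exists_end a j
  rw [hσ.before_iff hz hz' hz0 hz0'] at h
  have hi : Visible T a (ν.pos i) := visible_of_triangle (ν.mem_tiles i)
  have hj : Visible T a (ν.pos j) := visible_of_triangle (ν.mem_tiles j)
  exact ⟨fun hl => hz.lt_of_end_lt (add_two_ne a) hi hj hl hz' hz0 hz0' h,
    fun hl => hz'.lt_of_end_lt (add_one_ne a) hj hi hl hz hz0' hz0
      ((end_index_lt_iff hz hz' hz0 hz0').1 h)⟩

theorem IsSystemOfPermutations.not_before_all (hσ : IsSystemOfPermutations ν σ) (i j : Fin n) :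
    ¬ (Before σ 0 i j ∧ Before σ 1 i j ∧ Before σ 2 i j) := by
  rintro ⟨h0, h1, h2⟩
  have h0 := hσ.pos_lt_of_before h0
  have h1 := hσ.pos_lt_of_before h1
  have h2 := hσ.pos_lt_of_before h2
  simp only [show (0 : Fin 3) + 2 = 2 from rfl, show (0 : Fin 3) + 1 = 1 from rfl,
    show (1 : Fin 3) + 2 = 0 from rfl, show (1 : Fin 3) + 1 = 2 from rfl,
    show (2 : Fin 3) + 2 = 1 from rfl, show (2 : Fin 3) + 1 = 0 from rfl] at h0 h1 h2
  -- With `p a = pos j a - pos i a`, the hypotheses say that `p a ≤ 0` forces `p (a + 2) > 0` and `p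
  -- a ≥ 0` forces `p (a + 1) < 0`; no choice of three signs satisfies this cyclically.
  omega

theorem IsSystemOfPermutations.acyclic (hσ : IsSystemOfPermutations ν σ) : Acyclic σ := by
  rintro ⟨i, j, h⟩
  exact hσ.not_before_all i j ⟨h _, h _, h _⟩

theorem IsSystemOfPermutations.not_before_all_cyclic (hσ : IsSystemOfPermutations ν σ)
    (a : Fin 3) (i j : Fin n) :
    ¬ (Before σ a i j ∧ Before σ (a + 1) i j ∧ Before σ (a + 2) i j) := by
  have h := hσ.not_before_all i j
  fin_cases a <;> simp [show (2 : Fin 3) + 2 = 1 from rfl, show (2 : Fin 3) + 1 = 0 from rfl] <;>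
    tauto

/-! ### Positions as numbers of crossings. -/

theorem before_asymm {a : Fin 3} {i j : Fin n} (h : Before σ a i j) : ¬ Before σ a j i :=
  lt_asymm h

theorem before_or {a : Fin 3} {i j : Fin n} (h : i ≠ j) : Before σ a i j ∨ Before σ a j i :=
  lt_or_gt_of_ne ((σ (a + 1)).symm.injective.ne h)

/-- The numbers `j` that put `i` at the corner `b` in the tiling induced by `i` and `j`. -/
def Crosses (σ : Fin 3 → Equiv.Perm (Fin n)) (b : Fin 3) (i j : Fin n) : Prop :=
  (Before σ b j i ∧ Before σ (b + 1) j i) ∨ (Before σ b i j ∧ Before σ (b + 2) i j)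

/-- The path of `i` in direction `b` and that of `j` in direction `c` cross in the rhombus
`(y, d)`. -/
structure Crossing (ν : TriangleNumbering T) (i j : Fin n) (b c d : Fin 3) (y : Fin 3 → ℕ) :
    Prop where
  left_ne_right : b ≠ c
  left_ne_dir : b ≠ d
  right_ne_dir : c ≠ d
  mem_tiles : Tile.rhombus y d ∈ T.tiles
  left : Desc T b (ν.pos i) (y + Pi.single b 1)
  right : Desc T c (ν.pos j) (y + Pi.single c 1)

theorem Crossing.swap {i j : Fin n} {b c d : Fin 3} {y : Fin 3 → ℕ}
    (h : Crossing ν i j b c d y) : Crossing ν j i c b d y :=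
  ⟨h.1.symm, h.3, h.2, h.4, h.6, h.5⟩

theorem Crossing.before {i j : Fin n} {b c d : Fin 3} {y : Fin 3 → ℕ}
    (h : Crossing ν i j b c d y) (hσ : IsSystemOfPermutations ν σ) :
    (c = b + 1 ∧ Before σ b j i) ∨ (c = b + 2 ∧ Before σ b i j) := by
  obtain ⟨z, hz, hz0, -⟩ := hσ.exists_end b i
  obtain ⟨z', hz', hz0', -⟩ := hσ.exists_end b j
  have hlt := end_lt_of_crossing h.1 h.2 h.3 h.4 (visible_of_triangle (ν.mem_tiles i)) h.5 h.6
    hz hz' hz0 hz0'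
  rcases eq_add_one_or_of_ne h.1.symm with rfl | rfl
  · exact Or.inl ⟨rfl, by
      rwa [hσ.before_iff hz' hz hz0' hz0, end_index_lt_iff hz' hz hz0' hz0]⟩
  · exact Or.inr ⟨rfl, by rwa [hσ.before_iff hz hz' hz0 hz0']⟩

theorem Crossing.crosses {i j : Fin n} {b c d : Fin 3} {y : Fin 3 → ℕ}
    (h : Crossing ν i j b c d y) (hσ : IsSystemOfPermutations ν σ) : Crosses σ b i j := by
  rcases h.before hσ with ⟨rfl, h1⟩ | ⟨rfl, h1⟩
  · rcases h.swap.before hσ with ⟨h2, -⟩ | ⟨-, h2⟩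
    · rw [add_one_add_one] at h2; exact absurd h2.symm (add_two_ne b)
    · exact Or.inl ⟨h1, h2⟩
  · rcases h.swap.before hσ with ⟨-, h2⟩ | ⟨h2, -⟩
    · exact Or.inr ⟨h1, h2⟩
    · rw [add_two_add_two] at h2; exact absurd h2.symm (add_one_ne b)

theorem exists_crossing (ν : TriangleNumbering T) (i : Fin n) (b : Fin 3) {k : ℕ}
    (hk : k < ν.pos i b) : ∃ j c d y, Crossing ν i j b c d y ∧ y b = k := by
  have hv : Visible T b (ν.pos i) := visible_of_triangle (ν.mem_tiles i)
  -- The path enters the rhombus at `y + e_b`, one level above `y b = k`.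
  obtain ⟨x, hx, hxk⟩ := hv.exists_desc (k := k + 1) hk
  obtain ⟨z, y, d, ht, hd, rfl, -⟩ := (hv.of_desc hx).exists_step (by omega)
  obtain ⟨c, hbc, hcd⟩ := exists_third b d
  obtain ⟨w, hw, hwd⟩ := (visible_source_of_rhombus ht hcd).exists_triangle
  obtain ⟨j, rfl⟩ := ν.exists_pos_eq hw
  refine ⟨j, c, d, y, ⟨hbc, hd.symm, hcd, ht, hx, hwd⟩, ?_⟩
  rw [add_single_same] at hxk
  omega

open scoped Classical in
theorem IsSystemOfPermutations.pos_le_card (hσ : IsSystemOfPermutations ν σ) (i : Fin n)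
    (b : Fin 3) : ν.pos i b ≤ (Finset.univ.filter fun j => Crosses σ b i j).card := by
  have h : ∀ k : Fin (ν.pos i b), ∃ j c d y, Crossing ν i j b c d y ∧ y b = k :=
    fun k => exists_crossing ν i b k.2
  choose J C D Y hY hYk using h
  rw [← Fintype.card_fin (ν.pos i b), ← Finset.card_univ]
  refine Finset.card_le_card_of_injOn J (fun k _ => by simpa using (hY k).crosses hσ) ?_
  intro k _ l _ hJ
  -- The direction of the crossing path of `j` is dictated by the order of `i` and `j` opposite
  -- corner `b`; two crossings with the same `j` thus have the same shape and must coincide.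
  have hC : C k = C l := by
    rcases (hY k).before hσ with ⟨h1, h2⟩ | ⟨h1, h2⟩ <;>
      rcases (hY l).before hσ with ⟨h3, h4⟩ | ⟨h3, h4⟩
    · rw [h1, h3]
    · exact absurd h4 (hJ ▸ before_asymm h2)
    · exact absurd h4 (hJ ▸ before_asymm h2)
    · rw [h1, h3]
  have hD : D k = D l :=
    third_unique (hY k).1 (hY k).2 (hY k).3 (hY l).2 (hC ▸ (hY l).3)
  have h1 := hY k
  have h2 := hY l
  rw [← hJ, ← hC, ← hD] at h2
  have h3 := not_level_lt_of_crossings h1.1 h1.2 h1.3 h1.4 h2.4 h1.5 h2.5 h1.6 h2.6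
  have h4 := not_level_lt_of_crossings h1.1 h1.2 h1.3 h2.4 h1.4 h2.5 h1.5 h2.6 h1.6
  rw [hYk, hYk] at h3 h4
  exact Fin.ext (by omega)

theorem IsSystemOfPermutations.not_crosses_two (hσ : IsSystemOfPermutations ν σ) {i j : Fin n}
    {b b' : Fin 3} (hb : b ≠ b') (h : Crosses σ b i j) : ¬ Crosses σ b' i j := by
  intro h'
  have h1 := hσ.not_before_all i j
  have h2 := hσ.not_before_all j i
  have h3 : ∀ a, Before σ a i j → ¬ Before σ a j i := fun a => before_asymm
  have h30 := h3 0
  have h31 := h3 1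
  have h32 := h3 2
  clear h3
  fin_cases b <;> fin_cases b' <;>
    simp [Crosses, show (2 : Fin 3) + 2 = 1 from rfl, show (2 : Fin 3) + 1 = 0 from rfl,
      show (1 : Fin 3) + 2 = 0 from rfl, show (1 : Fin 3) + 1 = 2 from rfl] at h h' hb <;> tauto

open scoped Classical in
theorem IsSystemOfPermutations.pos_eq_card (hσ : IsSystemOfPermutations ν σ) (i : Fin n)
    (b : Fin 3) : ν.pos i b = (Finset.univ.filter fun j => Crosses σ b i j).card := by
  have hsum : ∑ b, (Finset.univ.filter fun j => Crosses σ b i j).card + 1 ≤ n := by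
    rw [← Finset.card_biUnion]
    · have : i ∉ Finset.univ.biUnion fun b => Finset.univ.filter fun j => Crosses σ b i j := by
        intro h
        obtain ⟨c, -, hc⟩ := Finset.mem_biUnion.1 h
        rcases (Finset.mem_filter.1 hc).2 with h | h <;> exact lt_irrefl _ h.1
      rw [← Finset.card_insert_of_notMem this]
      simpa using Finset.card_le_univ (α := Fin n) _
    · intro b _ b' _ hb
      refine Finset.disjoint_filter.2 ?_
      exact fun j _ h => hσ.not_crosses_two hb h
  have h := hσ.pos_le_card i
  have h0 := h b
  have h1 := h (b + 1)
  have h2 := h (b + 2)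
  rw [sum_eq_cyclic _ b] at hsum
  have := pos_sum ν i b
  omega

/-- Acyclicity makes the order on the third side irrelevant, so `Crosses` becomes an inversion
between two permutations. -/
theorem IsSystemOfPermutations.crosses_add_two_iff (hσ : IsSystemOfPermutations ν σ) (a : Fin 3)
    (i j : Fin n) : Crosses σ (a + 2) i j ↔ Before σ a j i ∧ Before σ (a + 1) i j := by
  have h1 := hσ.not_before_all_cyclic a i j
  have h2 := hσ.not_before_all_cyclic a j i
  rw [Crosses, add_two_add_one, add_two_add_two]
  by_cases hij : i = j
  · subst hij; simp [Before]
  have h3 := @before_or n σ a i j hij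
  have h4 := @before_or n σ (a + 1) i j hij
  have h5 := @before_or n σ (a + 2) i j hij
  tauto

theorem IsSystemOfPermutations.crosses_add_one_iff (hσ : IsSystemOfPermutations ν σ) (a : Fin 3)
    (i j : Fin n) : Crosses σ (a + 1) i j ↔ Before σ a i j ∧ Before σ (a + 2) j i := by
  have h1 := hσ.not_before_all_cyclic a i j
  have h2 := hσ.not_before_all_cyclic a j i
  rw [Crosses, add_one_add_one, add_one_add_two]
  by_cases hij : i = j
  · subst hij; simp [Before]
  have h3 := @before_or n σ a i j hij
  have h4 := @before_or n σ (a + 1) i j hij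
  have h5 := @before_or n σ (a + 2) i j hij
  tauto

end Numbering

/-! ### Recovering an order from inversion counts. -/

section LehmerCode

open scoped Classical in
/-- The relative order of the values of an injective function is determined by its inversion
counts. -/
theorem lt_iff_lt_of_inversions_eq {ι α β γ : Type*} [Fintype ι] [LinearOrder α] [LinearOrder β]
    [LinearOrder γ] {τ : ι → α} {f : ι → β} {g : ι → γ} (hτ : Function.Injective τ)
    (hf : Function.Injective f) (hg : Function.Injective g)
    (h : ∀ i, (Finset.univ.filter fun j => τ j < τ i ∧ f i < f j).card =
      (Finset.univ.filter fun j => τ j < τ i ∧ g i < g j).card) (i j : ι) :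
    f i < f j ↔ g i < g j := by
  have main : ∀ i, ∀ j, τ j ≤ τ i → ((f i < f j ↔ g i < g j) ∧ (f j < f i ↔ g j < g i)) := by
    intro i
    induction i using (Finite.wellFounded_of_trans_of_irrefl fun i j => τ i < τ j).induction with
    | _ i ih =>
    have ih' : ∀ j k, τ j < τ i → τ k < τ i → (f j < f k ↔ g j < g k) := by
      intro j k hj hk
      rcases le_total (τ k) (τ j) with h1 | h1
      · exact (ih j hj k h1).1
      · exact (ih k hk j h1).2
    -- By induction `f` and `g` order the predecessors of `i` alike, so both sets are upper sets of
    -- one linear order; equal size makes them equal.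
    have heq : (Finset.univ.filter fun j => τ j < τ i ∧ f i < f j) =
        Finset.univ.filter fun j => τ j < τ i ∧ g i < g j := by
      by_contra hne
      have h1 := fun hs => hne (Finset.eq_of_subset_of_card_le hs (h i).ge)
      have h2 := fun hs => hne (Finset.eq_of_subset_of_card_le hs (h i).le).symm
      obtain ⟨j, hj, hj'⟩ := Finset.not_subset.1 h1
      obtain ⟨k, hk, hk'⟩ := Finset.not_subset.1 h2
      simp only [Finset.mem_filter, Finset.mem_univ, true_and, not_and, not_lt] at hj hj' hk hk'
      have h3 := (ih' k j hk.1 hj.1).1 ((hk' hk.1).trans_lt hj.2)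
      exact lt_asymm h3 ((hj' hj.1).trans_lt hk.2)
    intro j hj
    rcases hj.eq_or_lt with h1 | h1
    · obtain rfl := hτ h1
      simp
    · have h2 := Finset.ext_iff.1 heq j
      simp only [Finset.mem_filter, Finset.mem_univ, true_and, h1] at h2
      have hne : i ≠ j := by rintro rfl; exact lt_irrefl _ h1
      refine ⟨h2, ?_⟩
      rw [← not_iff_not, not_lt, not_lt, (hf.ne hne).le_iff_lt, (hg.ne hne).le_iff_lt, h2]
  rcases le_total (τ j) (τ i) with h1 | h1
  · exact (main i j h1).1
  · exact (main j i h1).2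

/-- The only order automorphism of `Fin n` is the identity. -/
theorem perm_eq_of_symm_lt_iff {n : ℕ} {ρ ρ' : Equiv.Perm (Fin n)}
    (h : ∀ i j, ρ.symm i < ρ.symm j ↔ ρ'.symm i < ρ'.symm j) : ρ = ρ' := by
  have hm : StrictMono (ρ.trans ρ'.symm) := fun i j hij => by
    simpa using (h (ρ i) (ρ j)).1 (by simpa using hij)
  have h1 := Subsingleton.elim (hm.orderIsoOfSurjective _ (ρ.trans ρ'.symm).surjective)
    (OrderIso.refl (Fin n))
  ext1 i
  have h2 := congrArg (fun e => e i) h1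
  have h3 : ρ'.symm (ρ i) = i := h2
  rw [← h3, Equiv.apply_symm_apply, h3]

end LehmerCode

/-! ### Positions and permutations determine each other. -/

section Determination

variable {n : ℕ} {T T' : LozengeTiling n} {ν : TriangleNumbering T} {ν' : TriangleNumbering T'}
  {σ σ' : Fin 3 → Equiv.Perm (Fin n)}

theorem IsSystemOfPermutations.pos_eq (hσ : IsSystemOfPermutations ν σ)
    (hσ' : IsSystemOfPermutations ν' σ) : ν.pos = ν'.pos := by
  funext i b
  rw [hσ.pos_eq_card, hσ'.pos_eq_card]

theorem IsSystemOfPermutations.eq_of_pos_eq (hσ : IsSystemOfPermutations ν σ)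
    (hσ' : IsSystemOfPermutations ν' σ') (hpos : ν.pos = ν'.pos) {s : Fin 3} (hs : σ s = σ' s) :
    σ = σ' := by
  classical
  obtain ⟨a, rfl⟩ : ∃ a, s = a + 1 := ⟨s + 2, (add_two_add_one s).symm⟩
  have h1 : σ (a + 1 + 1) = σ' (a + 1 + 1) := by
    refine perm_eq_of_symm_lt_iff (lt_iff_lt_of_inversions_eq (σ (a + 1)).symm.injective
      (Equiv.injective _) (Equiv.injective _) fun i => ?_)
    have h := hσ.pos_eq_card i (a + 2)
    rw [hpos, hσ'.pos_eq_card i (a + 2)] at h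
    simp only [hσ.crosses_add_two_iff, hσ'.crosses_add_two_iff, Before, ← hs] at h
    exact h.symm
  have h2 : σ (a + 2 + 1) = σ' (a + 2 + 1) := by
    refine perm_eq_of_symm_lt_iff fun i j => ?_
    -- Here `crosses_add_one_iff` counts the `j` after `i` in the known permutation and before it in
    -- the other, so all orders are reversed.
    refine lt_iff_lt_of_inversions_eq (τ := fun i => OrderDual.toDual ((σ (a + 1)).symm i))
      (f := fun i => OrderDual.toDual ((σ (a + 2 + 1)).symm i))
      (g := fun i => OrderDual.toDual ((σ' (a + 2 + 1)).symm i))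
      (σ (a + 1)).symm.injective (σ (a + 2 + 1)).symm.injective (σ' (a + 2 + 1)).symm.injective
      (fun i => ?_) j i
    have h := hσ.pos_eq_card i (a + 1)
    rw [hpos, hσ'.pos_eq_card i (a + 1)] at h
    simp only [hσ.crosses_add_one_iff, hσ'.crosses_add_one_iff, Before, ← hs] at h
    exact h.symm
  funext c
  by_cases hc : c = a + 1
  · rw [hc, hs]
  · rcases eq_add_one_or_of_ne hc with rfl | rfl
    · exact h1
    · rwa [add_two_add_one, ← add_one_add_two a] at h2

end Determination

end Lozenge

theorem mainTheorem7 (n : ℕ) :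
    -- every numbered lozenge tiling has a well-defined system of permutations, and it is acyclic
    (∀ (T : Lozenge.LozengeTiling n) (ν : Lozenge.TriangleNumbering T),
      ∃! σ : Fin 3 → Equiv.Perm (Fin n), Lozenge.IsSystemOfPermutations ν σ) ∧
    (∀ (T : Lozenge.LozengeTiling n) (ν : Lozenge.TriangleNumbering T)
      (σ : Fin 3 → Equiv.Perm (Fin n)),
      Lozenge.IsSystemOfPermutations ν σ → Lozenge.Acyclic σ) ∧
    -- the system determines the numbered positions
    (∀ (T T' : Lozenge.LozengeTiling n)
      (ν : Lozenge.TriangleNumbering T) (ν' : Lozenge.TriangleNumbering T')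
      (σ : Fin 3 → Equiv.Perm (Fin n)),
      Lozenge.IsSystemOfPermutations ν σ → Lozenge.IsSystemOfPermutations ν' σ →
        ν.pos = ν'.pos) ∧
    -- the numbered positions and any one of the permutations determine the other two
    (∀ (T T' : Lozenge.LozengeTiling n)
      (ν : Lozenge.TriangleNumbering T) (ν' : Lozenge.TriangleNumbering T')
      (σ σ' : Fin 3 → Equiv.Perm (Fin n)),
      Lozenge.IsSystemOfPermutations ν σ → Lozenge.IsSystemOfPermutations ν' σ' →
        ν.pos = ν'.pos → ∀ s : Fin 3, σ s = σ' s → σ = σ') :=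
  ⟨fun _ ν => Lozenge.exists_unique_system ν, fun _ _ _ hσ => hσ.acyclic,
    fun _ _ _ _ _ hσ hσ' => hσ.pos_eq hσ', fun _ _ _ _ _ _ hσ hσ' hpos _ hs =>
      hσ.eq_of_pos_eq hσ' hpos hs⟩
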